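/- Let $(\Omega,\mathcal A,\mathbb P)$ be a probability space and let $U=(U_i)_{i\in I}$ be a family of random elements on $(\Omega,\mathcal A)$, with arbitrary index set $I$ and arbitrary measurable spaces $(E_i,\mathcal E_i)$ as codomains, which is independent under $\mathbb P$. Let $\Delta^\times$ be the set of all probability measures $P$ on $(\Omega,\mathcal A)$ such that $P$ and $\mathbb P$ are mutually absolutely continuous and the family $(U_i)_{i\in I}$ is independent under $P$. For a random element $X$, let $\sigma(X)$ denote the $\sigma$-algebra generated by $X$ together with the null sets $\{A\in\mathcal A:\mathbb P(A)=0\}$. Let $Z$ be a $\sigma(U)$-measurable random element with values in an arbitrary measurable space, and let $J:\Omega\to\mathfrak P(I)$ be a $\sigma(Z)$-measurable random index set, i.e. $\{\omega: i\in J(\omega)\}\in\sigma(Z)$ for all $i\in I$. Put $\bar J(\omega)=I\setminus J(\omega)$. For a random index set $K$, let $U_K$ be the random family $\omega\mapsto (U_i(\omega))_{i\in K(\omega)}$, with values in $\bigcup_{L\subseteq I}\prod_{i\in L}E_i$, which carries the smallest $\sigma$-algebra containing all the sets $\{x\in\prod_{k\in L}E_k : L\subseteq I,\ i\in L,\ x_i\in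 B\}$ with $i\in I$, $B\in\mathcal E_i$. For a probability measure $P$ equivalent to $\mathbb P$, write $U_J\perp\!\!\!\perp_P U_{\bar J}\mid Z$ if $P(A\mid\sigma(Z))\,P(B\mid\sigma(Z))=P(A\cap B\mid\sigma(Z))$ $P$-almost surely for all $A\in\sigma(U_J)$ and $B\in\sigma(U_{\bar J})$. Say that $J$ disintegrates $Z$ if $U_J\perp\!\!\!\perp_P U_{\bar J}\mid Z$ for every $P\in\Delta^\times$. Then $J$ disintegrates $Z$ if and only if $U_J\perp\!\!\!\perp_{\mathbb P}U_{\bar J}\mid Z$. -/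

import Mathlib

open MeasureTheory ProbabilityTheory

namespace StructIndep

/-- The sub-σ-algebra `m` of the ambient σ-algebra, completed with the null sets
`{A ∈ 𝒜 : μ A = 0}` of the reference measure `μ`. -/
@[reducible] def completed {Ω : Type*} [mΩ : MeasurableSpace Ω] (μ : Measure Ω) (m : MeasurableSpace Ω) :
    MeasurableSpace Ω :=
  m ⊔ MeasurableSpace.generateFrom {A : Set Ω | MeasurableSet[mΩ] A ∧ μ A = 0}

/-- `σ(X)`, completed with respect to the reference measure `μ`. -/
@[reducible] def sigma {Ω E : Type*} [MeasurableSpace Ω] [mE : MeasurableSpace E] (μ : Measure Ω)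
    (X : Ω → E) : MeasurableSpace Ω :=
  completed μ (mE.comap X)

/-- The associated random element `ω ↦ (U i ω)_{i ∈ I}` of a family, with values in the product
measurable space. -/
def joint {Ω I : Type*} {E : I → Type*} (U : ∀ i, Ω → E i) : Ω → ∀ i, E i :=
  fun ω i => U i ω

/-- The disjoint union, over all `K ⊆ I`, of the products `∏_{i ∈ K} E i`. -/
structure PartialFamily {I : Type*} (E : I → Type*) where
  /-- the index set `K` -/
  index : Set I
  /-- the family indexed by `K` -/
  val : ∀ i : index, E i

/-- The smallest σ-algebra that contains `{x ∈ ∏_{k ∈ K} E k : K ⊆ I, i ∈ K, x i ∈ B}` for all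
`i ∈ I` and all measurable `B ⊆ E i`. -/
instance {I : Type*} (E : I → Type*) [∀ i, MeasurableSpace (E i)] :
    MeasurableSpace (PartialFamily E) :=
  MeasurableSpace.generateFrom
    {S | ∃ (i : I) (B : Set (E i)), MeasurableSet B ∧
      S = {x : PartialFamily E | ∃ h : i ∈ x.index, x.val ⟨i, h⟩ ∈ B}}

/-- The random family `U_J`, that is `U_J(ω) = (U i ω)_{i ∈ J(ω)}`. -/
def randomFamily {Ω I : Type*} {E : I → Type*} (U : ∀ i, Ω → E i) (J : Ω → Set I) :
    Ω → PartialFamily E :=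
  fun ω => ⟨J ω, fun i => U i ω⟩

/-- Conditional independence of two σ-algebras given a sub-σ-algebra `m'`, with respect to `P`:
`P(A | m') P(B | m') = P(A ∩ B | m')` almost surely, for all `A ∈ m₁` and `B ∈ m₂`. -/
def CondIndepGiven {Ω : Type*} (m' m₁ m₂ : MeasurableSpace Ω) [MeasurableSpace Ω]
    (P : Measure Ω) : Prop :=
  ∀ A B : Set Ω, MeasurableSet[m₁] A → MeasurableSet[m₂] B →
    P[A.indicator (fun _ => (1 : ℝ)) | m'] * P[B.indicator (fun _ => (1 : ℝ)) | m']
      =ᵐ[P] P[(A ∩ B).indicator (fun _ => (1 : ℝ)) | m']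

/-- `Δ^×`: the probability measures equivalent to `μ` under which the family `U` is
independent. -/
def productMeasures {Ω I : Type*} {E : I → Type*} [MeasurableSpace Ω]
    [∀ i, MeasurableSpace (E i)] (μ : Measure Ω) (U : ∀ i, Ω → E i) : Set (Measure Ω) :=
  {P | IsProbabilityMeasure P ∧ iIndepFun U P ∧ P ≪ μ ∧ μ ≪ P}

/-- `U_J` and `U_{Jᶜ}` are conditionally independent given `Z` with respect to `P`; all generated
σ-algebras are completed with respect to the reference measure `μ`. -/
def SplitsGiven {Ω I F : Type*} {E : I → Type*} [MeasurableSpace Ω]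
    [∀ i, MeasurableSpace (E i)] [MeasurableSpace F] (μ : Measure Ω) (U : ∀ i, Ω → E i)
    (Z : Ω → F) (J : Ω → Set I) (P : Measure Ω) : Prop :=
  CondIndepGiven (sigma μ Z) (sigma μ (randomFamily U J))
    (sigma μ (randomFamily U (fun ω => (J ω)ᶜ))) P

/-- The `σ(Z)`-measurable random index set `J` disintegrates `Z`. -/
def Disintegrates {Ω I F : Type*} {E : I → Type*} [MeasurableSpace Ω]
    [∀ i, MeasurableSpace (E i)] [MeasurableSpace F] (μ : Measure Ω) (U : ∀ i, Ω → E i)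
    (Z : Ω → F) (J : Ω → Set I) : Prop :=
  ∀ P ∈ productMeasures μ U, SplitsGiven μ U Z J P

end StructIndep

/-! Only one direction needs work. Let `D` be the density of the law of `U` under `P` relative to
its law under `μ`, evaluated at `U`. All events involved lie in the completed `σ(U)`, so `D` may
replace `dP/dμ`. By Bayes' formula, conditional independence under `P` then becomes an identity
under `μ`: `E[1_A D|Z] E[1_B D|Z] = E[1_{A∩B} D|Z] E[D|Z]` (`CondIndepWeighted`).

If `D` is a finite product of bounded functions of single `U i`, sorting its factors by `i ∈ J ω`
gives `D = f * g` with `f` measurable for `U_J` and `g` for the complementary family, and the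
identity follows from conditional independence under `μ` (`CondIndepGiven.weighted_prod`).

Independence under both measures makes the conditional expectation of `D` given finitely many
coordinates a product of marginal densities (`condExp_jointDensity`). Such products approximate `D`
in `L¹` for any index set, and the identity is closed in `L¹` (`CondIndepWeighted.of_tendsto`). -/

namespace StructIndep

open Filter Topology

/-! ### Factorisation of conditional expectations: from indicators to bounded functions -/

section CondExp

variable {Ω : Type*} {m m' mΩ : MeasurableSpace Ω} {P : Measure Ω} [IsProbabilityMeasure P]
  {f g : Ω → ℝ}

/-- If `g` integrates to zero over all intersections of a set of `m` with a set of `m'`, then so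
does `f * g` for every `m`-measurable `f`, in conditional form. -/
theorem condExp_mul_eq_zero (hm : m ≤ mΩ) (hm' : m' ≤ mΩ) (hg : Integrable g P)
    (H : ∀ A, MeasurableSet[m] A → P[A.indicator g | m'] =ᵐ[P] 0)
    (hf : StronglyMeasurable[m] f) (hfg : Integrable (f * g) P) :
    P[f * g | m'] =ᵐ[P] 0 := by
  refine (ae_eq_condExp_of_forall_setIntegral_eq hm' hfg (fun _ _ _ => integrableOn_zero) ?_
    aestronglyMeasurable_zero).symm
  intro C hC _
  -- Both conditions say that `g` integrates to zero over every `A ∩ C`, so conditioning on `m'` can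
  -- be traded for conditioning on `m`, where `f` pulls out.
  have hCg : P[C.indicator g | m] =ᵐ[P] 0 := by
    refine (ae_eq_condExp_of_forall_setIntegral_eq hm (hg.indicator (hm' C hC))
      (fun _ _ _ => integrableOn_zero) ?_ aestronglyMeasurable_zero).symm
    intro A hA _
    have h1 : ∫ x in A, C.indicator g x ∂P = ∫ x in C, A.indicator g x ∂P := by
      rw [setIntegral_indicator (hm' C hC), setIntegral_indicator (hm A hA), Set.inter_comm]
    rw [h1, ← setIntegral_condExp hm' (hg.indicator (hm A hA)) hC,
      setIntegral_congr_ae (hm' C hC) ((H A hA).mono fun x hx _ => hx)]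
    simp
  have hmul : f * C.indicator g = C.indicator (f * g) := by
    ext x; by_cases hx : x ∈ C <;> simp [hx]
  have hint : Integrable (f * C.indicator g) P := hmul ▸ hfg.indicator (hm' C hC)
  have h2 : P[f * C.indicator g | m] =ᵐ[P] 0 := by
    filter_upwards [condExp_mul_of_stronglyMeasurable_left hf hint (hg.indicator (hm' C hC)), hCg]
      with x hx h0
    simp [hx, h0]
  have h3 : ∫ x in C, (f * g) x ∂P = 0 := by
    rw [← integral_indicator (hm' C hC), ← hmul, ← integral_condExp hm, integral_congr_ae h2]
    simp
  rw [h3]; simp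

/-- Factorisation of a conditional expectation extends from indicators of sets in `m` to bounded
`m`-measurable functions. -/
theorem condExp_mul_of_indicator (hm : m ≤ mΩ) (hm' : m' ≤ mΩ) (hg : Integrable g P)
    (H : ∀ A, MeasurableSet[m] A →
      P[A.indicator g | m'] =ᵐ[P] P[A.indicator (fun _ => (1 : ℝ)) | m'] * P[g | m'])
    (hf : StronglyMeasurable[m] f) {c : ℝ} (hc : ∀ ω, |f ω| ≤ c) :
    P[f * g | m'] =ᵐ[P] P[f | m'] * P[g | m'] := by
  have hfm : AEStronglyMeasurable f P := (hf.mono hm).aestronglyMeasurable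
  have hfi : Integrable f P := Integrable.of_bound hfm c (Eventually.of_forall hc)
  have hbdd : ∀ {u : Ω → ℝ}, Integrable u P → Integrable (f * u) P := fun hu =>
    hu.bdd_mul hfm (Eventually.of_forall hc)
  have hb : Integrable (P[g | m']) P := integrable_condExp
  have hfb := condExp_mul_of_stronglyMeasurable_right (stronglyMeasurable_condExp (m := m') (f := g)
    (μ := P)) (hbdd hb) hfi
  -- Centring: `g - P[g | m']` satisfies the vanishing hypothesis because `P[g | m']` pulls out.
  have key := condExp_mul_eq_zero hm hm' (hg.sub hb) (f := f) ?_ hf (hbdd (hg.sub hb))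
  · rw [mul_sub] at key
    filter_upwards [key, condExp_sub (hbdd hg) (hbdd hb) m', hfb] with x h1 h2 h3
    rw [h2] at h1
    simp only [Pi.sub_apply, Pi.zero_apply] at h1
    linarith
  · intro A hA
    have h1 : Integrable (A.indicator fun _ => (1 : ℝ)) P :=
      (integrable_const 1).indicator (hm A hA)
    have e1 : A.indicator (P[g | m']) = (A.indicator fun _ => (1 : ℝ)) * P[g | m'] := by
      ext x; by_cases hx : x ∈ A <;> simp [hx]
    have e2 := condExp_mul_of_stronglyMeasurable_right (stronglyMeasurable_condExp (m := m')
      (f := g) (μ := P)) (e1 ▸ hb.indicator (hm A hA)) h1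
    rw [← e1] at e2
    rw [Set.indicator_sub']
    filter_upwards [condExp_sub (hg.indicator (hm A hA)) (hb.indicator (hm A hA)) m', H A hA, e2]
      with x h1 h2 h3
    simp [h1, h2, h3]

end CondExp

/-! ### Weighted conditional independence, `L¹` limits and change of measure -/

section Weighted

variable {Ω : Type*} {m' m₁ m₂ mΩ : MeasurableSpace Ω} {μ : Measure Ω}

/-- Bounded measurable functions factorise under conditional independence. -/
theorem CondIndepGiven.condExp_mul [IsProbabilityMeasure μ] (hm' : m' ≤ mΩ) (hm₁ : m₁ ≤ mΩ)
    (hm₂ : m₂ ≤ mΩ) (h : CondIndepGiven m' m₁ m₂ μ) {f g : Ω → ℝ} {c d : ℝ}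
    (hf : StronglyMeasurable[m₁] f) (hc : ∀ ω, |f ω| ≤ c)
    (hg : StronglyMeasurable[m₂] g) (hd : ∀ ω, |g ω| ≤ d) :
    μ[f * g | m'] =ᵐ[μ] μ[f | m'] * μ[g | m'] := by
  have hfi : Integrable f μ := Integrable.of_bound (hf.mono hm₁).aestronglyMeasurable c
    (Eventually.of_forall hc)
  rw [mul_comm f g, mul_comm (μ[f | m'])]
  refine condExp_mul_of_indicator hm₂ hm' hfi (fun B hB => ?_) hg hd
  have e1 : B.indicator f = f * B.indicator fun _ => (1 : ℝ) := by
    ext x; by_cases hx : x ∈ B <;> simp [hx]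
  rw [e1, mul_comm (μ[B.indicator _ | m'])]
  refine condExp_mul_of_indicator hm₁ hm' ((integrable_const 1).indicator (hm₂ B hB))
    (fun A hA => ?_) hf hc
  rw [Set.indicator_indicator]
  exact (h A B hA hB).symm

/-- Conditional independence of two events given `m'`, for the finite measure with density `D` with
respect to `μ`. -/
def CondIndepWeighted (m' : MeasurableSpace Ω) [MeasurableSpace Ω] (μ : Measure Ω) (A B : Set Ω)
    (D : Ω → ℝ) : Prop :=
  μ[A.indicator D | m'] * μ[B.indicator D | m'] =ᵐ[μ] μ[(A ∩ B).indicator D | m'] * μ[D | m']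

/-- The indicator of `A` is absorbed by `f` and that of `B` by `g`, so both sides become `E[1_A f]
E[1_B g] E[f] E[g]`, all conditional on `m'`. -/
theorem CondIndepGiven.weighted_mul [IsProbabilityMeasure μ] (hm' : m' ≤ mΩ) (hm₁ : m₁ ≤ mΩ)
    (hm₂ : m₂ ≤ mΩ) (h : CondIndepGiven m' m₁ m₂ μ) {f g : Ω → ℝ} {c d : ℝ}
    (hf : StronglyMeasurable[m₁] f) (hc : ∀ ω, |f ω| ≤ c)
    (hg : StronglyMeasurable[m₂] g) (hd : ∀ ω, |g ω| ≤ d) {A B : Set Ω}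
    (hA : MeasurableSet[m₁] A) (hB : MeasurableSet[m₂] B) :
    CondIndepWeighted m' μ A B (f * g) := by
  have bd : ∀ {u : Ω → ℝ} {e : ℝ} (S : Set Ω), (∀ ω, |u ω| ≤ e) → ∀ ω, |S.indicator u ω| ≤ e := by
    intro u e S hu ω
    by_cases hω : ω ∈ S
    · simpa [hω] using hu ω
    · simpa [hω] using (abs_nonneg _).trans (hu ω)
  have e1 : A.indicator (f * g) = A.indicator f * g := by
    ext x; by_cases hx : x ∈ A <;> simp [hx]
  have e2 : B.indicator (f * g) = f * B.indicator g := by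
    ext x; by_cases hx : x ∈ B <;> simp [hx]
  have e3 : (A ∩ B).indicator (f * g) = A.indicator f * B.indicator g := by
    ext x; exact Set.inter_indicator_mul f g x
  unfold CondIndepWeighted
  rw [e1, e2, e3]
  filter_upwards [h.condExp_mul hm' hm₁ hm₂ hf hc hg hd,
    h.condExp_mul hm' hm₁ hm₂ (hf.indicator hA) (bd A hc) hg hd,
    h.condExp_mul hm' hm₁ hm₂ hf hc (hg.indicator hB) (bd B hd),
    h.condExp_mul hm' hm₁ hm₂ (hf.indicator hA) (bd A hc) (hg.indicator hB) (bd B hd)]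
    with x h1 h2 h3 h4
  simp only [Pi.mul_apply] at *
  rw [h1, h2, h3, h4]; ring

/-- Conditional expectation contracts `L¹`; convergence in `L¹` gives convergence in measure, hence
almost everywhere along a subsequence. -/
theorem exists_subseq_condExp_indicator {D : Ω → ℝ} {Dn : ℕ → Ω → ℝ} (hD : Integrable D μ)
    (hDn : ∀ n, Integrable (Dn n) μ)
    (hlim : Tendsto (fun n => eLpNorm (Dn n - D) 1 μ) atTop (𝓝 0)) {A : Set Ω}
    (hA : MeasurableSet A) :
    ∃ ns : ℕ → ℕ, StrictMono ns ∧ ∀ᵐ x ∂μ,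
      Tendsto (fun n => (μ[A.indicator (Dn (ns n)) | m']) x) atTop
        (𝓝 ((μ[A.indicator D | m']) x)) := by
  by_cases hm' : m' ≤ mΩ
  swap
  · exact ⟨id, strictMono_id, by simp [condExp_of_not_le hm']⟩
  refine (tendstoInMeasure_of_tendsto_eLpNorm one_ne_zero
    (fun n => (integrable_condExp (m := m') (f := A.indicator (Dn n))).aestronglyMeasurable)
    integrable_condExp.aestronglyMeasurable ?_).exists_seq_tendsto_ae
  refine tendsto_of_tendsto_of_tendsto_of_le_of_le tendsto_const_nhds hlim (fun _ => zero_le)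
    fun n => ?_
  calc eLpNorm (μ[A.indicator (Dn n) | m'] - μ[A.indicator D | m']) 1 μ
      = eLpNorm (μ[A.indicator (Dn n - D) | m']) 1 μ := by
        refine eLpNorm_congr_ae ?_
        rw [Set.indicator_sub']
        exact (condExp_sub ((hDn n).indicator hA) (hD.indicator hA) m').symm
    _ ≤ eLpNorm (A.indicator (Dn n - D)) 1 μ := eLpNorm_condExp_le_eLpNorm _ le_rfl
    _ ≤ eLpNorm (Dn n - D) 1 μ := eLpNorm_indicator_le _

/-- The set of densities for which two events are conditionally independent is closed in `L¹`. -/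
theorem CondIndepWeighted.of_tendsto {D : Ω → ℝ} {Dn : ℕ → Ω → ℝ} (hD : Integrable D μ)
    (hDn : ∀ n, Integrable (Dn n) μ)
    (hlim : Tendsto (fun n => eLpNorm (Dn n - D) 1 μ) atTop (𝓝 0)) {A B : Set Ω}
    (hA : MeasurableSet A) (hB : MeasurableSet B)
    (h : ∀ n, CondIndepWeighted m' μ A B (Dn n)) : CondIndepWeighted m' μ A B D := by
  -- Successive extraction: all four conditional expectations converge along the last subsequence.
  obtain ⟨a, ha, ta⟩ := exists_subseq_condExp_indicator (m' := m') hD hDn hlim hA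
  obtain ⟨b, hb, tb⟩ := exists_subseq_condExp_indicator (m' := m') hD (fun n => hDn (a n))
    (hlim.comp ha.tendsto_atTop) hB
  obtain ⟨c, hc, tc⟩ := exists_subseq_condExp_indicator (m' := m') hD (fun n => hDn (a (b n)))
    (hlim.comp (ha.comp hb).tendsto_atTop) (hA.inter hB)
  obtain ⟨d, hd, td⟩ := exists_subseq_condExp_indicator (m' := m') hD
    (fun n => hDn (a (b (c n)))) (hlim.comp ((ha.comp hb).comp hc).tendsto_atTop)
    MeasurableSet.univ
  simp only [Set.indicator_univ] at td
  filter_upwards [ta, tb, tc, td, ae_all_iff.2 fun n => h (a (b (c (d n))))] with x xa xb xc xd xh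
  have ta' := xa.comp ((hb.comp hc).comp hd).tendsto_atTop
  have tb' := xb.comp (hc.comp hd).tendsto_atTop
  have tc' := xc.comp hd.tendsto_atTop
  exact tendsto_nhds_unique (ta'.mul tb') ((tc'.mul xd).congr fun n => (xh n).symm)

/-- Bayes' formula for conditional expectations under a change of measure. -/
theorem condExp_mul_condExp_rnDeriv [IsFiniteMeasure μ] {P : Measure Ω} [IsFiniteMeasure P]
    (hP : P ≪ μ) (hm' : m' ≤ mΩ) {X : Ω → ℝ} (hX : Integrable X P) :
    P[X | m'] * μ[fun ω => (P.rnDeriv μ ω).toReal | m']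
      =ᵐ[μ] μ[fun ω => (P.rnDeriv μ ω).toReal * X ω | m'] := by
  set L : Ω → ℝ := fun ω => (P.rnDeriv μ ω).toReal
  have hL : Integrable L μ := Measure.integrable_toReal_rnDeriv
  have hY : Integrable (P[X | m']) P := integrable_condExp
  have hLX : Integrable (fun ω => L ω * X ω) μ := (integrable_rnDeriv_smul_iff hP).2 hX
  have hLY : Integrable (fun ω => L ω * (P[X | m']) ω) μ := (integrable_rnDeriv_smul_iff hP).2 hY
  have hYL : Integrable (P[X | m'] * L) μ := by
    rw [mul_comm]; exact hLY
  refine (condExp_mul_of_stronglyMeasurable_left stronglyMeasurable_condExp hYL hL).symm.trans ?_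
  refine ae_eq_condExp_of_forall_setIntegral_eq hm' hLX
    (fun _ _ _ => integrable_condExp.integrableOn) ?_ stronglyMeasurable_condExp.aestronglyMeasurable
  intro C hC _
  have tr : ∀ Y : Ω → ℝ, ∫ ω in C, L ω * Y ω ∂μ = ∫ ω in C, Y ω ∂P := by
    intro Y
    rw [← integral_indicator (hm' C hC), ← integral_indicator (hm' C hC),
      ← integral_rnDeriv_smul hP]
    congr 1; ext ω; by_cases hω : ω ∈ C <;> simp [hω, L]
  rw [setIntegral_condExp hm' hYL hC, tr X, ← setIntegral_condExp hm' hX hC, ← tr (P[X | m']),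
    mul_comm (P[X | m'])]
  rfl

/-- The zero set is in `m'`, so its `P`-measure is the integral of zero over it. This allows
division in Bayes' formula. -/
theorem condExp_rnDeriv_ne_zero [IsFiniteMeasure μ] {P : Measure Ω} [IsFiniteMeasure P]
    (hP : P ≪ μ) (hμ : μ ≪ P) (hm' : m' ≤ mΩ) :
    ∀ᵐ ω ∂μ, (μ[fun ω => (P.rnDeriv μ ω).toReal | m']) ω ≠ 0 := by
  set C : Set Ω := {ω | (μ[fun ω => (P.rnDeriv μ ω).toReal | m']) ω = 0}
  have hC : MeasurableSet[m'] C :=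
    stronglyMeasurable_condExp.measurable (measurableSet_singleton 0)
  have h0 : P.real C = 0 := by
    rw [← Measure.setIntegral_toReal_rnDeriv hP,
      ← setIntegral_condExp hm' Measure.integrable_toReal_rnDeriv hC,
      setIntegral_congr_fun (g := fun _ => 0) (hm' C hC) fun ω hω => hω]
    simp
  have : μ C = 0 := hμ ((measureReal_eq_zero_iff).1 h0)
  exact measure_eq_zero_iff_ae_notMem.1 this

end Weighted

end StructIndep

namespace StructIndep

open Filter Topology

/-! ### Completed σ-algebras -/

section Completion

variable {Ω : Type*} {m mΩ : MeasurableSpace Ω} {μ : Measure Ω}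

theorem le_completed : m ≤ completed μ m := le_sup_left

theorem completed_le (hm : m ≤ mΩ) : completed μ m ≤ mΩ :=
  sup_le hm (MeasurableSpace.generateFrom_le fun _ hA => hA.1)

/-- A set of the completed σ-algebra agrees almost everywhere with a set of the original one. -/
theorem exists_measurableSet_ae_eq_of_completed {A : Set Ω} (hA : MeasurableSet[completed μ m] A) :
    ∃ B, MeasurableSet[m] B ∧ A =ᵐ[μ] B := by
  have h : completed μ m ≤ eventuallyMeasurableSpace m (ae μ) :=
    sup_le le_eventuallyMeasurableSpace (MeasurableSpace.generateFrom_le fun S hS =>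
      ⟨∅, @MeasurableSet.empty _ m, ae_eq_empty.2 hS.2⟩)
  exact h A hA

end Completion

/-! ### Densities of laws and approximation by finitely many coordinates -/

section Density

variable {Ω : Type*} {mΩ : MeasurableSpace Ω} {μ P : Measure Ω}

/-- The density of the law of `X` under `P` integrates to `P` on `σ(X)`. -/
theorem setIntegral_rnDeriv_map [IsFiniteMeasure μ] [IsFiniteMeasure P] (hP : P ≪ μ) {F : Type*}
    [MeasurableSpace F] {X : Ω → F} (hX : Measurable X) {B : Set F} (hB : MeasurableSet B) :
    ∫ ω in X ⁻¹' B, ((P.map X).rnDeriv (μ.map X) (X ω)).toReal ∂μ = P.real (X ⁻¹' B) := by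
  rw [← setIntegral_map (f := fun y => ((P.map X).rnDeriv (μ.map X) y).toReal) hB
    (Measure.measurable_rnDeriv _ _).ennreal_toReal.aestronglyMeasurable hX.aemeasurable,
    Measure.setIntegral_toReal_rnDeriv (hP.map hX), map_measureReal_apply hX hB]

/-- For finite families that are independent under both measures, the density of the joint law is
the product of the densities of the marginal laws. -/
theorem setLIntegral_prod_rnDeriv_map {ι : Type*} [Fintype ι] {E : ι → Type*}
    [∀ i, MeasurableSpace (E i)] [IsProbabilityMeasure μ] [IsProbabilityMeasure P] (hP : P ≪ μ)
    {V : ∀ i, Ω → E i} (hV : ∀ i, Measurable (V i)) (hμ : iIndepFun V μ) (hPV : iIndepFun V P)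
    {B : Set (∀ i, E i)} (hB : MeasurableSet B) :
    ∫⁻ ω in (fun ω i => V i ω) ⁻¹' B, ∏ i, (P.map (V i)).rnDeriv (μ.map (V i)) (V i ω) ∂μ
      = P ((fun ω i => V i ω) ⁻¹' B) := by
  set q : ∀ i, E i → ENNReal := fun i => (P.map (V i)).rnDeriv (μ.map (V i))
  have hq : ∀ i, Measurable (q i) := fun i => Measure.measurable_rnDeriv _ _
  have hX : Measurable fun ω i => V i ω := measurable_pi_iff.2 hV
  have h1 := (iIndepFun_iff_map_fun_eq_pi_map fun i => (hV i).aemeasurable).1 hPV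
  have : ∀ i, IsProbabilityMeasure (P.map (V i)) :=
    fun i => Measure.isProbabilityMeasure_map (hV i).aemeasurable
  -- It suffices to compare on boxes, where the integral factors by independence under `μ`.
  have h2 : Measure.pi (fun i => P.map (V i))
      = (μ.withDensity fun ω => ∏ i, q i (V i ω)).map fun ω i => V i ω := by
    refine Measure.pi_eq fun s hs => ?_
    have hS : MeasurableSet ((fun ω i => V i ω) ⁻¹' Set.univ.pi s) :=
      hX (MeasurableSet.univ_pi hs)
    rw [Measure.map_apply hX (MeasurableSet.univ_pi hs), withDensity_apply _ hS,
      ← lintegral_indicator hS]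
    have e : ∀ ω, ((fun ω i => V i ω) ⁻¹' Set.univ.pi s).indicator
        (fun ω => ∏ i, q i (V i ω)) ω = ∏ i, ((s i).indicator (q i) ∘ V i) ω := by
      intro ω
      by_cases hω : ∀ i, V i ω ∈ s i
      · rw [Set.indicator_of_mem (by simpa using hω)]
        exact Finset.prod_congr rfl fun i _ => by simp [hω i]
      · rw [Set.indicator_of_notMem (by simpa using hω)]
        obtain ⟨i, hi⟩ := not_forall.1 hω
        exact (Finset.prod_eq_zero (Finset.mem_univ i) (by simp [hi])).symm
    simp_rw [e]
    rw [lintegral_prod_eq_prod_lintegral_of_indepFun _ _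
      (hμ.comp _ fun i => (hq i).indicator (hs i))
      (fun i => ((hq i).indicator (hs i)).comp (hV i))]
    refine Finset.prod_congr rfl fun i _ => ?_
    simp only [Function.comp_apply]
    rw [← lintegral_map ((hq i).indicator (hs i)) (hV i), lintegral_indicator (hs i),
      Measure.setLIntegral_rnDeriv (hP.map (hV i))]
  rw [← Measure.map_apply hX hB, h1, h2, Measure.map_apply hX hB, withDensity_apply _ (hX hB)]

/-- Integrable functions on a product space are approximated in `L¹` by functions of finitely many
coordinates. -/
theorem exists_finset_eLpNorm_sub_le {I : Type*} {E : I → Type*} [∀ i, MeasurableSpace (E i)]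
    {ν : Measure (∀ i, E i)} [IsFiniteMeasure ν] {d : (∀ i, E i) → ℝ} (hd : Integrable d ν)
    {ε : ENNReal} (hε : ε ≠ 0) :
    ∃ g : (∀ i, E i) → ℝ, eLpNorm (d - g) 1 ν ≤ ε ∧ ∃ S : Finset I, Integrable g ν ∧
      StronglyMeasurable[MeasurableSpace.comap S.restrict MeasurableSpace.pi] g := by
  classical
  refine (memLp_one_iff_integrable.2 hd).induction_dense ENNReal.one_ne_top _ ?_ ?_ ?_ hε
  · intro c s hs _ ε hε
    obtain ⟨η, hη, hηε⟩ := exists_eLpNorm_indicator_le (p := 1) (μ := ν) ENNReal.one_ne_top c hε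
    obtain ⟨t, ht, hst⟩ := (Measure.MeasureDense.of_generateFrom_isSetAlgebra_finite ν
      isSetAlgebra_measurableCylinders generateFrom_measurableCylinders.symm).approx s hs
      (measure_ne_top _ _) η (by exact_mod_cast hη)
    obtain ⟨S, T, hT, rfl⟩ := (mem_measurableCylinders t).1 ht
    refine ⟨(cylinder S T).indicator fun _ => c, ?_, S,
      (integrable_const c).indicator (hT.cylinder S), ?_⟩
    · rw [eLpNorm_indicator_sub_indicator, symmDiff_comm]
      exact hηε _ (by simpa using hst.le)
    · exact stronglyMeasurable_const.indicator ⟨T, hT, rfl⟩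
  · rintro f g ⟨S, hfi, hf⟩ ⟨T, hgi, hg⟩
    have mono : ∀ {S T : Finset I}, S ⊆ T →
        MeasurableSpace.comap (S.restrict (π := E)) MeasurableSpace.pi
          ≤ MeasurableSpace.comap T.restrict MeasurableSpace.pi := by
      intro S T h
      rw [← Finset.restrict₂_comp_restrict h, ← MeasurableSpace.comap_comp]
      exact MeasurableSpace.comap_mono (Finset.measurable_restrict₂ h).comap_le
    exact ⟨S ∪ T, hfi.add hgi, (hf.mono (mono Finset.subset_union_left)).add
      (hg.mono (mono Finset.subset_union_right))⟩
  · rintro f ⟨S, hfi, -⟩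
    exact hfi.aestronglyMeasurable

end Density

/-! ### Random subfamilies -/

section Family

variable {Ω I : Type*} {E : I → Type*} {m' mΩ : MeasurableSpace Ω} [∀ i, MeasurableSpace (E i)]

theorem measurable_joint {U : ∀ i, Ω → E i} (hU : ∀ i, Measurable (U i)) :
    Measurable (joint U) := measurable_pi_iff.2 hU

theorem measurableSet_partialFamily (i : I) {B : Set (E i)} (hB : MeasurableSet B) :
    MeasurableSet {x : PartialFamily E | ∃ h : i ∈ x.index, x.val ⟨i, h⟩ ∈ B} :=
  MeasurableSpace.measurableSet_generateFrom ⟨i, B, hB, rfl⟩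

-- The default value 1 makes absent indices neutral in products.
open Classical in
theorem measurable_partialFamily_dite (i : I) {φ : E i → ℝ} (hφ : Measurable φ) :
    Measurable fun x : PartialFamily E => if h : i ∈ x.index then φ (x.val ⟨i, h⟩) else 1 := by
  intro B hB
  have h1 := measurableSet_partialFamily (E := E) i (hφ hB)
  have h2 : MeasurableSet {x : PartialFamily E | i ∈ x.index} := by
    simpa using measurableSet_partialFamily (E := E) i MeasurableSet.univ
  have e : (fun x : PartialFamily E => if h : i ∈ x.index then φ (x.val ⟨i, h⟩) else 1) ⁻¹' B
      = {x | ∃ h : i ∈ x.index, x.val ⟨i, h⟩ ∈ φ ⁻¹' B} ∪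
        ({x | i ∈ x.index}ᶜ ∩ {_x | (1 : ℝ) ∈ B}) := by
    ext x
    by_cases h : i ∈ x.index <;> simp [h]
  rw [e]
  exact h1.union (h2.compl.inter (MeasurableSet.const _))

theorem measurable_randomFamily {U : ∀ i, Ω → E i} {J : Ω → Set I}
    (hU : ∀ i, Measurable (U i)) (hJ : ∀ i, MeasurableSet {ω | i ∈ J ω}) :
    Measurable (randomFamily U J) := by
  refine measurable_generateFrom ?_
  rintro _ ⟨i, B, hB, rfl⟩
  have e : randomFamily U J ⁻¹' {x : PartialFamily E | ∃ h : i ∈ x.index, x.val ⟨i, h⟩ ∈ B}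
      = {ω | i ∈ J ω} ∩ U i ⁻¹' B := by
    ext ω; simp [randomFamily]
  rw [e]
  exact (hJ i).inter (hU i hB)

open Classical in
/-- A finite product of functions of the members of a family splits, along a random index set, into
factors measurable with respect to the two random subfamilies. -/
theorem CondIndepGiven.weighted_prod {μ : Measure Ω} [IsProbabilityMeasure μ]
    (hm' : m' ≤ mΩ) {U : ∀ i, Ω → E i} {J : Ω → Set I}
    (h₁ : sigma μ (randomFamily U J) ≤ mΩ) (h₂ : sigma μ (randomFamily U fun ω => (J ω)ᶜ) ≤ mΩ)
    (h : CondIndepGiven m' (sigma μ (randomFamily U J))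
      (sigma μ (randomFamily U fun ω => (J ω)ᶜ)) μ)
    (S : Finset I) {φ : ∀ i, E i → ℝ} (hφ : ∀ i, Measurable (φ i)) {c : ℝ}
    (hφc : ∀ i x, |φ i x| ≤ c) {A B : Set Ω} (hA : MeasurableSet[sigma μ (randomFamily U J)] A)
    (hB : MeasurableSet[sigma μ (randomFamily U fun ω => (J ω)ᶜ)] B) :
    CondIndepWeighted m' μ A B fun ω => ∏ i ∈ S, φ i (U i ω) := by
  set ψ : PartialFamily E → ℝ :=
    fun x => ∏ i ∈ S, if h : i ∈ x.index then φ i (x.val ⟨i, h⟩) else 1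
  have hψ : Measurable ψ :=
    Finset.measurable_prod _ fun i _ => measurable_partialFamily_dite i (hφ i)
  have hψc : ∀ x, |ψ x| ≤ ∏ _i ∈ S, max c 1 := by
    intro x
    rw [Finset.abs_prod]
    refine Finset.prod_le_prod (fun _ _ => abs_nonneg _) fun i _ => ?_
    split_ifs
    · exact (hφc i _).trans (le_max_left _ _)
    · simp
  have hmeas : ∀ K : Ω → Set I,
      StronglyMeasurable[sigma μ (randomFamily U K)] (ψ ∘ randomFamily U K) := fun K =>
    ((hψ.comp (comap_measurable (randomFamily U K))).mono le_completed le_rfl).stronglyMeasurable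
  have e : (fun ω => ∏ i ∈ S, φ i (U i ω))
      = (ψ ∘ randomFamily U J) * (ψ ∘ randomFamily U fun ω => (J ω)ᶜ) := by
    ext ω
    simp only [Pi.mul_apply, Function.comp_apply, ψ, randomFamily, ← Finset.prod_mul_distrib]
    refine Finset.prod_congr rfl fun i _ => ?_
    by_cases hi : i ∈ J ω <;> simp [hi]
  rw [e]
  exact h.weighted_mul hm' h₁ h₂ (hmeas _) (fun _ => hψc _) (hmeas _) (fun _ => hψc _) hA hB

end Family

end StructIndep

namespace StructIndep

open Filter Topology

/-! ### The joint density and transfer to an equivalent measure -/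

section Family

variable {Ω I : Type*} {E : I → Type*} {m' mΩ : MeasurableSpace Ω} [∀ i, MeasurableSpace (E i)]
  {μ P : Measure Ω} {U : ∀ i, Ω → E i}

/-- The product of the densities of the marginal laws of finitely many members of a family. -/
noncomputable def finiteDensity (μ P : Measure Ω) (U : ∀ i, Ω → E i) (S : Finset I) (ω : Ω) : ℝ :=
  ∏ i ∈ S, ((P.map (U i)).rnDeriv (μ.map (U i)) (U i ω)).toReal

/-- The density of the joint law of a family, as a function on the sample space. -/
noncomputable def jointDensity (μ P : Measure Ω) (U : ∀ i, Ω → E i) (ω : Ω) : ℝ :=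
  ((P.map (joint U)).rnDeriv (μ.map (joint U)) (joint U ω)).toReal

theorem measurable_finiteDensity {m : MeasurableSpace Ω} (S : Finset I)
    (hm : ∀ i ∈ S, Measurable[m] (U i)) : Measurable[m] (finiteDensity μ P U S) :=
  Finset.measurable_prod _ fun i hi =>
    (Measure.measurable_rnDeriv _ _).ennreal_toReal.comp (hm i hi)

theorem integrable_jointDensity [IsFiniteMeasure P] (hU : ∀ i, Measurable (U i)) :
    Integrable (jointDensity μ P U) μ :=
  (Measure.integrable_toReal_rnDeriv (μ := P.map (joint U)) (ν := μ.map (joint U))).comp_measurable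
    (measurable_joint hU)

variable [IsProbabilityMeasure μ] [IsProbabilityMeasure P]

theorem setLIntegral_finiteDensity (hP : P ≪ μ) (hU : ∀ i, Measurable (U i)) (hμ : iIndepFun U μ)
    (hPU : iIndepFun U P) (S : Finset I) {B : Set (∀ i : S, E i)} (hB : MeasurableSet B) :
    ∫⁻ ω in (S.restrict ∘ joint U) ⁻¹' B,
      ∏ i ∈ S, (P.map (U i)).rnDeriv (μ.map (U i)) (U i ω) ∂μ
      = P ((S.restrict ∘ joint U) ⁻¹' B) := by
  have h := setLIntegral_prod_rnDeriv_map (V := fun i : S => U i) hP (fun i => hU i)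
    (hμ.precomp Subtype.val_injective) (hPU.precomp Subtype.val_injective) hB
  refine Eq.trans (lintegral_congr fun ω => ?_) h
  exact (Finset.prod_coe_sort S fun i => (P.map (U i)).rnDeriv (μ.map (U i)) (U i ω)).symm

theorem integrable_finiteDensity (hP : P ≪ μ) (hU : ∀ i, Measurable (U i)) (hμ : iIndepFun U μ)
    (hPU : iIndepFun U P) (S : Finset I) : Integrable (finiteDensity μ P U S) μ := by
  have h := setLIntegral_finiteDensity hP hU hμ hPU S MeasurableSet.univ
  have e : finiteDensity μ P U S
      = fun ω => (∏ i ∈ S, (P.map (U i)).rnDeriv (μ.map (U i)) (U i ω)).toReal := by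
    ext ω; simp [finiteDensity, ENNReal.toReal_prod]
  rw [e]
  refine integrable_toReal_of_lintegral_ne_top
    (Finset.measurable_prod _ fun i _ => (Measure.measurable_rnDeriv _ _).comp (hU i)).aemeasurable ?_
  rw [Set.preimage_univ, setLIntegral_univ] at h
  rw [h]; exact measure_ne_top _ _

theorem setIntegral_finiteDensity (hP : P ≪ μ) (hU : ∀ i, Measurable (U i)) (hμ : iIndepFun U μ)
    (hPU : iIndepFun U P) (S : Finset I) {B : Set (∀ i : S, E i)} (hB : MeasurableSet B) :
    ∫ ω in (S.restrict ∘ joint U) ⁻¹' B, finiteDensity μ P U S ω ∂μ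
      = P.real ((S.restrict ∘ joint U) ⁻¹' B) := by
  have hm : Measurable fun ω => ∏ i ∈ S, (P.map (U i)).rnDeriv (μ.map (U i)) (U i ω) :=
    Finset.measurable_prod _ fun i _ => (Measure.measurable_rnDeriv _ _).comp (hU i)
  rw [measureReal_def, ← setLIntegral_finiteDensity hP hU hμ hPU S hB,
    ← integral_toReal hm.aemeasurable]
  · simp [finiteDensity, ENNReal.toReal_prod]
  · refine ae_lt_top' hm.aemeasurable ?_
    rw [setLIntegral_finiteDensity hP hU hμ hPU S hB]
    exact measure_ne_top _ _

/-- Over an event determined by the coordinates in `S`, both densities integrate to its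
`P`-probability. -/
theorem condExp_jointDensity (hP : P ≪ μ) (hU : ∀ i, Measurable (U i)) (hμ : iIndepFun U μ)
    (hPU : iIndepFun U P) (S : Finset I) :
    finiteDensity μ P U S
      =ᵐ[μ] μ[jointDensity μ P U | MeasurableSpace.comap (S.restrict ∘ joint U) inferInstance] := by
  have hS : Measurable (S.restrict ∘ joint U) :=
    (Finset.measurable_restrict S).comp (measurable_joint hU)
  refine ae_eq_condExp_of_forall_setIntegral_eq hS.comap_le (integrable_jointDensity hU)
    (fun _ _ _ => (integrable_finiteDensity hP hU hμ hPU S).integrableOn) ?_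
    (measurable_finiteDensity S fun i hi =>
      (measurable_pi_apply (⟨i, hi⟩ : S)).comp
        (comap_measurable (S.restrict ∘ joint U))).aestronglyMeasurable
  rintro _ ⟨B, hB, rfl⟩ _
  rw [setIntegral_finiteDensity hP hU hμ hPU S hB]
  exact (setIntegral_rnDeriv_map hP (measurable_joint hU)
    (Finset.measurable_restrict S hB)).symm

/-- The joint density is an `L¹`-limit of finite products of marginal densities. -/
theorem exists_finiteDensity_approx (hP : P ≪ μ) (hU : ∀ i, Measurable (U i)) (hμ : iIndepFun U μ)
    (hPU : iIndepFun U P) {ε : ENNReal} (hε : ε ≠ 0) :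
    ∃ S : Finset I, eLpNorm (finiteDensity μ P U S - jointDensity μ P U) 1 μ ≤ ε + ε := by
  have hJ := measurable_joint hU
  obtain ⟨g, hg, S, hgi, hgm⟩ := exists_finset_eLpNorm_sub_le
    (Measure.integrable_toReal_rnDeriv (μ := P.map (joint U)) (ν := μ.map (joint U))) hε
  have hS : Measurable (S.restrict ∘ joint U) := (Finset.measurable_restrict S).comp hJ
  have hD : Integrable (jointDensity μ P U) μ := integrable_jointDensity hU
  have hG : Integrable (g ∘ joint U) μ := hgi.comp_measurable hJ
  have hGm : StronglyMeasurable[MeasurableSpace.comap (S.restrict ∘ joint U) inferInstance]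
      (g ∘ joint U) := by
    rw [← MeasurableSpace.comap_comp]
    exact hgm.comp_measurable (comap_measurable (m := MeasurableSpace.comap S.restrict _) (joint U))
  have hle : eLpNorm (jointDensity μ P U - g ∘ joint U) 1 μ ≤ ε := by
    refine le_of_eq_of_le ?_ hg
    rw [eLpNorm_map_measure ((Measure.integrable_toReal_rnDeriv).sub hgi).aestronglyMeasurable
      hJ.aemeasurable]
    rfl
  refine ⟨S, ?_⟩
  set D := jointDensity μ P U
  set G := g ∘ joint U
  set mS := MeasurableSpace.comap (S.restrict ∘ joint U) inferInstance
  -- Since `G` is `mS`-measurable it cancels; each remaining term has norm at most `ε`.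
  have e : finiteDensity μ P U S - D =ᵐ[μ] μ[D - G | mS] - (D - G) := by
    filter_upwards [condExp_jointDensity hP hU hμ hPU S, condExp_sub hD hG mS] with x h1 h2
    have h3 : (μ[G | mS]) x = G x := by rw [condExp_of_stronglyMeasurable hS.comap_le hGm hG]
    simp only [Pi.sub_apply, h2, h3, h1]
    ring
  rw [eLpNorm_congr_ae e]
  calc eLpNorm (μ[D - G | mS] - (D - G)) 1 μ
      ≤ eLpNorm (μ[D - G | mS]) 1 μ + eLpNorm (D - G) 1 μ :=
        eLpNorm_sub_le integrable_condExp.aestronglyMeasurable (hD.sub hG).aestronglyMeasurable le_rfl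
    _ ≤ eLpNorm (D - G) 1 μ + eLpNorm (D - G) 1 μ := by
        gcongr; exact eLpNorm_condExp_le_eLpNorm _ le_rfl
    _ ≤ ε + ε := add_le_add hle hle

/-- Conditional independence of random subfamilies persists under finite products of marginal
densities. -/
theorem CondIndepGiven.weighted_finiteDensity (hP : P ≪ μ) (hU : ∀ i, Measurable (U i))
    (hμ : iIndepFun U μ) (hPU : iIndepFun U P) (hm' : m' ≤ mΩ) {J : Ω → Set I}
    (h₁ : sigma μ (randomFamily U J) ≤ mΩ) (h₂ : sigma μ (randomFamily U fun ω => (J ω)ᶜ) ≤ mΩ)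
    (h : CondIndepGiven m' (sigma μ (randomFamily U J))
      (sigma μ (randomFamily U fun ω => (J ω)ᶜ)) μ) (S : Finset I)
    {A B : Set Ω} (hA : MeasurableSet[sigma μ (randomFamily U J)] A)
    (hB : MeasurableSet[sigma μ (randomFamily U fun ω => (J ω)ᶜ)] B) :
    CondIndepWeighted m' μ A B (finiteDensity μ P U S) := by
  set q : ∀ i, E i → ℝ := fun i x => ((P.map (U i)).rnDeriv (μ.map (U i)) x).toReal
  have hq : ∀ i, Measurable (q i) := fun i => (Measure.measurable_rnDeriv _ _).ennreal_toReal
  have hq0 : ∀ i x, 0 ≤ q i x := fun i x => ENNReal.toReal_nonneg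
  -- Marginal densities may be unbounded, so they are truncated at `n`; the full product dominates.
  have hφ : ∀ (n : ℕ) (i), Measurable fun x => min (q i x) (n : ℝ) :=
    fun n i => (hq i).min measurable_const
  have hint := integrable_finiteDensity hP hU hμ hPU S
  have h0 : ∀ (n : ℕ) i x, 0 ≤ min (q i x) (n : ℝ) := fun n i x =>
    le_min (hq0 i x) n.cast_nonneg
  have hFm : ∀ n : ℕ, AEStronglyMeasurable (fun ω => ∏ i ∈ S, min (q i (U i ω)) (n : ℝ)) μ :=
    fun n => (Finset.measurable_prod _ fun i _ => (hφ n i).comp (hU i)).aestronglyMeasurable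
  have hbd : ∀ (n : ℕ) ω, ‖∏ i ∈ S, min (q i (U i ω)) (n : ℝ)‖ ≤ finiteDensity μ P U S ω := by
    intro n ω
    rw [Real.norm_of_nonneg (Finset.prod_nonneg fun i _ => h0 n i _)]
    exact Finset.prod_le_prod (fun i _ => h0 n i _) fun i _ => min_le_left _ _
  refine CondIndepWeighted.of_tendsto (Dn := fun n ω => ∏ i ∈ S, min (q i (U i ω)) (n : ℝ)) hint
    (fun n => hint.mono' (hFm n) (Eventually.of_forall (hbd n))) ?_ (h₁ A hA) (h₂ B hB) fun n =>
      h.weighted_prod hm' h₁ h₂ S (hφ n) (c := n)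
        (fun i x => by rw [abs_of_nonneg (h0 n i x)]; exact min_le_right _ _) hA hB
  have hlim := tendsto_lintegral_norm_of_dominated_convergence hFm hint.hasFiniteIntegral
    (fun n => Eventually.of_forall (hbd n)) (f := finiteDensity μ P U S)
    (Eventually.of_forall fun ω => tendsto_finsetProd S fun i _ => by
      obtain ⟨N, hN⟩ := exists_nat_ge (q i (U i ω))
      refine tendsto_const_nhds.congr' ?_
      filter_upwards [eventually_ge_atTop N] with n hn
      exact (min_eq_left (hN.trans (by exact_mod_cast hn))).symm)
  simpa only [eLpNorm_one_eq_lintegral_enorm, ofReal_norm, Pi.sub_apply] using hlim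

theorem CondIndepGiven.weighted_jointDensity (hP : P ≪ μ) (hU : ∀ i, Measurable (U i))
    (hμ : iIndepFun U μ) (hPU : iIndepFun U P) (hm' : m' ≤ mΩ) {J : Ω → Set I}
    (h₁ : sigma μ (randomFamily U J) ≤ mΩ) (h₂ : sigma μ (randomFamily U fun ω => (J ω)ᶜ) ≤ mΩ)
    (h : CondIndepGiven m' (sigma μ (randomFamily U J))
      (sigma μ (randomFamily U fun ω => (J ω)ᶜ)) μ)
    {A B : Set Ω} (hA : MeasurableSet[sigma μ (randomFamily U J)] A)
    (hB : MeasurableSet[sigma μ (randomFamily U fun ω => (J ω)ᶜ)] B) :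
    CondIndepWeighted m' μ A B (jointDensity μ P U) := by
  -- Here `ε = 1/n`; at `n = 0` it is `∞`, which is harmless.
  choose S hS using fun n => exists_finiteDensity_approx hP hU hμ hPU
    (ENNReal.inv_ne_zero.2 (ENNReal.natCast_ne_top n))
  refine CondIndepWeighted.of_tendsto (Dn := fun n => finiteDensity μ P U (S n))
    (integrable_jointDensity hU) (fun n => integrable_finiteDensity hP hU hμ hPU _) ?_
    (h₁ A hA) (h₂ B hB) fun n =>
      h.weighted_finiteDensity hP hU hμ hPU hm' h₁ h₂ (S n) hA hB
  refine tendsto_of_tendsto_of_tendsto_of_le_of_le tendsto_const_nhds ?_ (fun _ => zero_le) hS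
  simpa using ENNReal.tendsto_inv_nat_nhds_zero.add ENNReal.tendsto_inv_nat_nhds_zero

/-- On events of the completed σ-algebra of the family, the density of `P` may be replaced by that
of the joint law. -/
theorem condExp_rnDeriv_mul_indicator (hP : P ≪ μ) (hU : ∀ i, Measurable (U i))
    (hm' : m' ≤ sigma μ (joint U)) {A : Set Ω} (hA : MeasurableSet[sigma μ (joint U)] A) :
    μ[fun ω => (P.rnDeriv μ ω).toReal * A.indicator (fun _ => (1 : ℝ)) ω | m']
      =ᵐ[μ] μ[A.indicator (jointDensity μ P U) | m'] := by
  have hJ := measurable_joint hU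
  have hle : sigma μ (joint U) ≤ mΩ := completed_le hJ.comap_le
  have hL : Integrable (fun ω => (P.rnDeriv μ ω).toReal) μ := Measure.integrable_toReal_rnDeriv
  have hD : Integrable (jointDensity μ P U) μ := integrable_jointDensity hU
  have e : (fun ω => (P.rnDeriv μ ω).toReal * A.indicator (fun _ => (1 : ℝ)) ω)
      = A.indicator fun ω => (P.rnDeriv μ ω).toReal := by
    ext ω; by_cases hω : ω ∈ A <;> simp [hω]
  rw [e]
  refine (ae_eq_condExp_of_forall_setIntegral_eq (hm'.trans hle) (hD.indicator (hle A hA))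
    (fun _ _ _ => integrable_condExp.integrableOn) ?_
    stronglyMeasurable_condExp.aestronglyMeasurable)
  intro C hC _
  rw [setIntegral_condExp (hm'.trans hle) (hL.indicator (hle A hA)) hC,
    setIntegral_indicator (hle A hA), setIntegral_indicator (hle A hA)]
  -- Up to a null set `C ∩ A` is an event of the uncompleted `σ(U)`, on which both densities
  -- integrate to `P`.
  obtain ⟨_, ⟨T, hT, rfl⟩, hCT⟩ := exists_measurableSet_ae_eq_of_completed
    (MeasurableSet.inter (hm' C hC) hA)
  rw [setIntegral_congr_set hCT, setIntegral_congr_set hCT, Measure.setIntegral_toReal_rnDeriv hP]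
  exact (setIntegral_rnDeriv_map hP hJ hT).symm

/-- Conditional independence of random subfamilies is invariant under equivalent changes of measure
that preserve independence of the family. -/
theorem CondIndepGiven.of_mem_productMeasures (hU : ∀ i, Measurable (U i)) (hμ : iIndepFun U μ)
    (hP : P ∈ productMeasures μ U) (hm' : m' ≤ sigma μ (joint U)) {J : Ω → Set I}
    (h₁ : sigma μ (randomFamily U J) ≤ sigma μ (joint U))
    (h₂ : sigma μ (randomFamily U fun ω => (J ω)ᶜ) ≤ sigma μ (joint U))
    (h : CondIndepGiven m' (sigma μ (randomFamily U J))
      (sigma μ (randomFamily U fun ω => (J ω)ᶜ)) μ) :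
    CondIndepGiven m' (sigma μ (randomFamily U J))
      (sigma μ (randomFamily U fun ω => (J ω)ᶜ)) P := by
  obtain ⟨-, hPU, hPμ, hμP⟩ := hP
  have hle : sigma μ (joint U) ≤ mΩ := completed_le (measurable_joint hU).comap_le
  intro A B hA hB
  refine hPμ.ae_le ?_
  have bayes : ∀ {T : Set Ω}, MeasurableSet[sigma μ (joint U)] T →
      P[T.indicator (fun _ => (1 : ℝ)) | m'] * μ[fun ω => (P.rnDeriv μ ω).toReal | m']
        =ᵐ[μ] μ[T.indicator (jointDensity μ P U) | m'] := fun hT =>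
    (condExp_mul_condExp_rnDeriv hPμ (hm'.trans hle)
      ((integrable_const 1).indicator (hle _ hT))).trans
      (condExp_rnDeriv_mul_indicator hPμ hU hm' hT)
  have huniv := condExp_rnDeriv_mul_indicator hPμ hU hm' (MeasurableSet.univ)
  simp only [Set.indicator_univ, mul_one] at huniv
  filter_upwards [bayes (h₁ A hA), bayes (h₂ B hB), bayes ((h₁ A hA).inter (h₂ B hB)), huniv,
    condExp_rnDeriv_ne_zero hPμ hμP (hm'.trans hle),
    h.weighted_jointDensity hPμ hU hμ hPU (hm'.trans hle) (h₁.trans hle) (h₂.trans hle) hA hB]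
    with ω hA hB hAB h1 h0 hw
  simp only [Pi.mul_apply] at *
  rw [← hA, ← hB, ← hAB, ← h1] at hw
  -- Each side of the weighted identity carries the Bayes normaliser twice.
  refine mul_right_cancel₀ (mul_ne_zero h0 h0) ?_
  linarith

end Family

theorem measurableSet_mem_of_measurable {Ω I : Type*} {_ : MeasurableSpace Ω} {J : Ω → Set I}
    (hJ : Measurable J) (i : I) : MeasurableSet {ω | i ∈ J ω} :=
  hJ (measurableSet_setOfPred.2 (measurable_set_mem i))

end StructIndep

theorem lemma7p10 {Ω I F : Type*} {E : I → Type*} [MeasurableSpace Ω]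
    [∀ i, MeasurableSpace (E i)] [MeasurableSpace F]
    (μ : Measure Ω) [IsProbabilityMeasure μ]
    (U : ∀ i, Ω → E i) (hU : ∀ i, Measurable (U i)) (hind : iIndepFun U μ)
    (Z : Ω → F) (hZ : Measurable[StructIndep.sigma μ (StructIndep.joint U)] Z)
    (J : Ω → Set I) (hJ : Measurable[StructIndep.sigma μ Z] J) :
    StructIndep.Disintegrates μ U Z J ↔ StructIndep.SplitsGiven μ U Z J μ := by
  refine ⟨fun h => h μ ⟨inferInstance, hind, .rfl, .rfl⟩, fun h P hP => ?_⟩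
  have := hP.1
  have hZU : StructIndep.sigma μ Z ≤ StructIndep.sigma μ (StructIndep.joint U) :=
    sup_le hZ.comap_le le_sup_right
  have hUU : ∀ i, Measurable[StructIndep.sigma μ (StructIndep.joint U)] (U i) := fun i =>
    ((measurable_pi_apply i).comp (comap_measurable (StructIndep.joint U))).mono StructIndep.le_completed le_rfl
  have hJi : ∀ i, MeasurableSet[StructIndep.sigma μ (StructIndep.joint U)] {ω | i ∈ J ω} :=
    fun i => hZU _ (StructIndep.measurableSet_mem_of_measurable hJ i)
  exact h.of_mem_productMeasures hU hind hP hZU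
    (sup_le (StructIndep.measurable_randomFamily hUU hJi).comap_le le_sup_right)
    (sup_le (StructIndep.measurable_randomFamily hUU fun i => (hJi i).compl).comap_le le_sup_right)
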